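/- Let $\alpha$ be the standard flat Riemannian metric on $M=\mathbb{R}^2\setminus\{0\}$, let $\mathcal V_1=\langle\partial_\theta\rangle$ and $\mathcal V_2=\langle\partial_r\rangle$ be the $\alpha$-orthogonal line subbundles of $TM$ spanned by the polar coordinate vector fields, and for $y\in T_xM$ let $\alpha_i(y)$ be the $\alpha$-length of the $\alpha$-orthogonal projection of $y$ to $(\mathcal V_i)_x$, $i=1,2$. A *Finsler metric* on $M$ is a continuous function $F\colon TM\to[0,\infty)$, smooth on $TM\setminus 0$, such that on each tangent space $F(y)=0$ only for $y=0$, $F(\lambda y)=\lambda F(y)$ for $\lambda>0$, and the Hessian matrix $g_{ij}=\frac12[F^2]_{y^iy^j}$ is positive definite for $y\neq0$. It is *Riemannian* if $F^2$ is a quadratic form on each tangent space. It is a *Landsberg metric* if in every local coordinate system $x=(x^i)$ on $M$, with $y=y^j\partial_{x^j}$, the geodesic spray coefficients $$G^i=\tfrac14 g^{il}\left([F^2]_{x^ky^l}y^k-[F^2]_{x^l}\right)$$ satisfy $y^jg_{ij}[G^i]_{y^py^qy^r}=0$ for all $p,q,r$ and all $y\ne0$ (with summation over repeated indices). Let $F$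 be a Finsler metric on $M$ of the form $F=\sqrt{L(\alpha_1^2,\alpha_2^2)}$ for some real function $L$ of two variables. If $F$ is not Riemannian, then $F$ is not a Landsberg metric. -/

import Mathlib

open scoped ContDiff

noncomputable section

namespace Finsler

/-- The model space `ℝⁿ`, with its standard inner product. -/
abbrev Vec (n : ℕ) : Type := EuclideanSpace ℝ (Fin n)

/-- The partial derivative `∂f/∂yⁱ` at `y`. -/
def partialD {n : ℕ} (i : Fin n) (f : Vec n → ℝ) (y : Vec n) : ℝ :=
  fderiv ℝ f y (EuclideanSpace.single i 1)

/-- The Hessian matrix `g_ij(y) = ½ [N²]_{yⁱ yʲ}` of a function `N` on `ℝⁿ`. -/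
def hessianMatrix {n : ℕ} (N : Vec n → ℝ) (y : Vec n) : Matrix (Fin n) (Fin n) ℝ :=
  Matrix.of fun i j => (1 / 2 : ℝ) * partialD j (partialD i fun z => N z ^ 2) y

/-- Minkowski norms on `ℝⁿ` (not necessarily reversible). -/
structure IsMinkowskiNorm {n : ℕ} (N : Vec n → ℝ) : Prop where
  continuous : Continuous N
  nonneg : ∀ y, 0 ≤ N y
  eq_zero_iff : ∀ y, N y = 0 ↔ y = 0
  homogeneous : ∀ (c : ℝ) (y : Vec n), 0 < c → N (c • y) = c * N y
  smooth : ContDiffOn ℝ ∞ N {0}ᶜ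
  posDef : ∀ y, y ≠ 0 → (hessianMatrix N y).PosDef

/-- `F` is a Finsler metric on the open set `U ⊆ ℝⁿ`. The tangent bundle is `TU = U × ℝⁿ`, and
`F x y` is the value of the metric at the tangent vector `y ∈ T_x U`; the values of `F x` for
`x ∉ U` are irrelevant. -/
structure IsFinslerMetric {n : ℕ} (U : Set (Vec n)) (F : Vec n → Vec n → ℝ) : Prop where
  continuous : ContinuousOn (fun p : Vec n × Vec n => F p.1 p.2) (U ×ˢ Set.univ)
  smooth : ContDiffOn ℝ ∞ (fun p : Vec n × Vec n => F p.1 p.2) (U ×ˢ {0}ᶜ)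
  minkowski : ∀ x ∈ U, IsMinkowskiNorm (F x)

/-- `F` is Riemannian on `U`: `F²` is a quadratic form on each tangent space. -/
def IsRiemannian {n : ℕ} (U : Set (Vec n)) (F : Vec n → Vec n → ℝ) : Prop :=
  ∀ x ∈ U, ∃ Q : QuadraticForm ℝ (Vec n), ∀ y, F x y ^ 2 = Q y

/-- The coefficients `Gⁱ = ¼ g^{il} ([F²]_{xᵏ yˡ} yᵏ - [F²]_{xˡ})` of the geodesic spray
`yⁱ ∂_{xⁱ} - 2 Gⁱ ∂_{yⁱ}`, where `F` is a function of the standard local coordinates `(x, y)`. -/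
def sprayCoeff {n : ℕ} (F : Vec n → Vec n → ℝ) (x y : Vec n) (i : Fin n) : ℝ :=
  (1 / 4 : ℝ) * ∑ l, (hessianMatrix (F x) y)⁻¹ i l *
    ((∑ k, partialD l (fun z => partialD k (fun w => F w z ^ 2) x) y * y k)
      - partialD l (fun w => F w y ^ 2) x)

/-- A (smooth) local coordinate system on the open set `U ⊆ ℝⁿ`: a diffeomorphism between an
open subset of `U` and an open subset of `ℝⁿ`. -/
structure IsLocalCoordinates {n : ℕ} (U : Set (Vec n))
    (φ : OpenPartialHomeomorph (Vec n) (Vec n)) : Prop where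
  source_subset : φ.source ⊆ U
  smooth : ContDiffOn ℝ ∞ φ φ.source
  smooth_symm : ContDiffOn ℝ ∞ φ.symm φ.target

/-- The function `F` on `TU` written in the standard local coordinates `(x, y)` on the tangent
bundle induced by the coordinate system `φ`, i.e. at the tangent vector `yʲ ∂_{xʲ}` based at the
point with coordinates `x`. -/
def inCoordinates {n : ℕ} (φ : OpenPartialHomeomorph (Vec n) (Vec n))
    (F : Vec n → Vec n → ℝ) (x y : Vec n) : ℝ :=
  F (φ.symm x) (fderiv ℝ φ.symm x y)

/-- The Landsberg condition `yʲ g_ij [Gⁱ]_{yᵖ y^q yʳ} = 0` (for `y ≠ 0` and all `p, q, r`), in any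
local coordinate system of `U`. -/
def IsLandsberg {n : ℕ} (U : Set (Vec n)) (F : Vec n → Vec n → ℝ) : Prop :=
  ∀ φ : OpenPartialHomeomorph (Vec n) (Vec n), IsLocalCoordinates U φ →
    ∀ x ∈ φ.target, ∀ y : Vec n, y ≠ 0 → ∀ p q r : Fin n,
      ∑ i, ∑ j, y j * hessianMatrix (inCoordinates φ F x) y i j *
        partialD r (partialD q (partialD p
          fun z => sprayCoeff (inCoordinates φ F) x z i)) y = 0

/-- For the flat metric `α = ‖·‖` and a field `V` of tangent subspaces, the restriction of `α` to
`V` viewed as a function on the tangent bundle, through the `α`-orthogonal projection onto `V`. -/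
def alphaPart {n : ℕ} (V : Vec n → Submodule ℝ (Vec n)) (x y : Vec n) : ℝ :=
  ‖(V x).starProjection y‖

/-- `F` is an `(α₁, α₂)`-metric on `U` for the flat metric `α` and the orthogonal decomposition
`TU = V₁ ⊕ V₂` (the fields of subspaces `V₁`, `V₂` are given, and are meant to be smooth and
orthogonal complements of each other): a Finsler metric of the form `F = √(L(α₁², α₂²))`. -/
structure IsAlphaOneTwoMetric {n : ℕ} (U : Set (Vec n))
    (V₁ V₂ : Vec n → Submodule ℝ (Vec n)) (F : Vec n → Vec n → ℝ) : Prop where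
  finsler : IsFinslerMetric U F
  exists_eq_sqrt : ∃ L : ℝ → ℝ → ℝ, ∀ x ∈ U, ∀ y,
    F x y = Real.sqrt (L (alphaPart V₁ x y ^ 2) (alphaPart V₂ x y ^ 2))

/-- The manifold `ℝ² \ {0}`. -/
def puncturedPlane : Set (Vec 2) := {0}ᶜ

/-- The coordinate vector field `∂_θ` of the polar coordinates `(r cos θ, r sin θ)`. -/
def dTheta (x : Vec 2) : Vec 2 := !₂[-x 1, x 0]

/-- The coordinate vector field `∂_r` of the polar coordinates `(r cos θ, r sin θ)`. -/
def dRadius (x : Vec 2) : Vec 2 := ‖x‖⁻¹ • x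

/-- The line bundle spanned by `∂_θ`. -/
def angularBundle (x : Vec 2) : Submodule ℝ (Vec 2) := Submodule.span ℝ {dTheta x}

/-- The line bundle spanned by `∂_r`. -/
def radialBundle (x : Vec 2) : Submodule ℝ (Vec 2) := Submodule.span ℝ {dRadius x}

/-- On the punctured plane the two line bundles form an orthogonal decomposition. -/
theorem radialBundle_orthogonal (x : Vec 2) (hx : x ≠ 0) :
    (radialBundle x)ᗮ = angularBundle x := by
  have hn : ‖x‖ ≠ 0 := by simpa using hx
  ext y
  have : (radialBundle x)= Submodule.span ℝ {x} := by
    unfold radialBundle dRadius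
    exact Submodule.span_singleton_smul_eq (IsUnit.mk0 _ (inv_ne_zero hn)) x
  rw [this, Submodule.mem_orthogonal_singleton_iff_inner_right, angularBundle, Submodule.mem_span_singleton]
  simp only [PiLp.inner_apply, Fin.sum_univ_two]
  have h2 : x 0 ^2 + x 1 ^2 ≠ 0 := by
    intro h; apply hx; ext i; fin_cases i <;> simp <;> nlinarith [sq_nonneg (x 0), sq_nonneg (x 1)]
  constructor
  · intro h
    refine ⟨(x 0 * y 1 - x 1 * y 0)/(x 0 ^2 + x 1 ^2), ?_⟩
    simp at h
    ext i; fin_cases i <;> simp [dTheta] <;> field_simp <;> [linear_combination (-x 0) * h; linear_combination (-x 1)*h]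
  · rintro ⟨a, rfl⟩
    simp [dTheta]; ring

end Finsler

end

open scoped ContDiff

noncomputable section

namespace Finsler

/-! In logarithmic polar coordinates `(log r, θ)` the metric is `e^{x⁰} N(y)`, where `N` is the norm
at `(1, 0)`. Since it depends only on `α₁²` and `α₂²`, `N` is invariant under both coordinate
reflections. It is enough to use the Landsberg condition at the origin of this chart, with all three
`y`-derivatives in the angular direction.

Put `f t = N (1, t) ^ 2`, `D = 2 f f'' - f'^2` (four times the determinant of the Hessian matrix)
and `k = f' / D`. On the line `(1, t)` the spray coefficients are `(1 - f' k) / 2` and `t (1 - f' k)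
/ 2 + f k`, and the condition becomes an ODE for `f`. It says that `f'` times a factor of `J'`
vanishes, where `J = (f D')^2 / D^3` is the square of the main scalar of `N`. Strict convexity and
evenness leave `t = 0` as the only zero of `f'`, so `J` is constant; it vanishes at `0` because
`f'''` is odd. As `D' = 2 f f'''`, it follows that `f''' = 0` and `f = a + b t^2`. Homogeneity,
continuity and reflection extend this to `N^2 = a (y⁰)^2 + b (y¹)^2`, so `F` is Riemannian.

The ODE is solved in `deriv_deriv_deriv_eq_zero_of_landsberg`, the chart is computed in
`inCoordinates_logPolar`, and `lineEnergy_eq_of_landsberg` joins the two. -/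

/-! ### The ordinary differential equation. -/

/-- The derivative of a smooth function of one variable, at a point. -/
theorem hasDerivAt_deriv_of_contDiff {f : ℝ → ℝ} (hf : ContDiff ℝ ∞ f) (t : ℝ) :
    HasDerivAt f (deriv f t) t :=
  ((hf.differentiable (by simp)) t).hasDerivAt

theorem contDiff_deriv_of_contDiff {f : ℝ → ℝ} (hf : ContDiff ℝ ∞ f) : ContDiff ℝ ∞ (deriv f) :=
  (contDiff_infty_iff_deriv.mp hf).2

/-- The derivative of an even function is odd. -/
theorem deriv_neg_of_even {f : ℝ → ℝ} (h : ∀ t, f (-t) = f t) (t : ℝ) :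
    deriv f (-t) = -deriv f t := by
  have h1 : (fun s => f (-s)) = f := funext h
  have h2 := deriv_comp_neg f t
  rw [h1] at h2
  linarith

/-- The derivative of an odd function is even. -/
theorem deriv_neg_of_odd {f : ℝ → ℝ} (h : ∀ t, f (-t) = -f t) (t : ℝ) :
    deriv f (-t) = deriv f t := by
  have h1 : (fun s => f (-s)) = fun s => -f s := funext h
  have h2 := deriv_comp_neg f t
  rw [h1, deriv.fun_neg] at h2
  linarith

/-- The Landsberg equation in one variable: if the restriction `f` of an energy to an affine line
has vanishing Landsberg curvature, then its third derivative vanishes. -/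
theorem deriv_deriv_deriv_eq_zero_of_landsberg {f k : ℝ → ℝ} (hf : ContDiff ℝ ∞ f)
    (hk : ContDiff ℝ ∞ k) (heven : ∀ t, f (-t) = f t) (hpos : ∀ t, 0 < f t)
    (hpos2 : ∀ t, 0 < deriv (deriv f) t)
    (hD : ∀ t, 0 < 2 * f t * deriv (deriv f) t - deriv f t ^ 2)
    (hkD : ∀ t, k t * (2 * f t * deriv (deriv f) t - deriv f t ^ 2) = deriv f t)
    (hL : ∀ t, (2 * f t - t * deriv f t) *
        deriv (deriv (deriv fun s => (1 - deriv f s * k s) / 2)) t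
      + deriv f t *
        deriv (deriv (deriv fun s => s * ((1 - deriv f s * k s) / 2) + f s * k s)) t = 0)
    (t : ℝ) : deriv (deriv (deriv f)) t = 0 := by
  have hfc1 := contDiff_deriv_of_contDiff hf
  have hfc2 := contDiff_deriv_of_contDiff hfc1
  have hfc3 := contDiff_deriv_of_contDiff hfc2
  have hkc1 := contDiff_deriv_of_contDiff hk
  have hkc2 := contDiff_deriv_of_contDiff hkc1
  have e0 := hasDerivAt_deriv_of_contDiff hf
  have e1 := hasDerivAt_deriv_of_contDiff hfc1
  have e2 := hasDerivAt_deriv_of_contDiff hfc2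
  have e3 := hasDerivAt_deriv_of_contDiff hfc3
  have j0 := hasDerivAt_deriv_of_contDiff hk
  have j1 := hasDerivAt_deriv_of_contDiff hkc1
  have j2 := hasDerivAt_deriv_of_contDiff hkc2
  have odd1 := deriv_neg_of_even heven
  have odd3 := deriv_neg_of_even (deriv_neg_of_odd odd1)
  -- The highest derivative goes first, so that no replacement destroys a longer tower. Afterwards
  -- the functions are tied together only by the `HasDerivAt` facts.
  generalize deriv (deriv (deriv (deriv f))) = f4 at *
  generalize deriv (deriv (deriv f)) = f3 at *
  generalize deriv (deriv f) = f2 at *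
  generalize deriv f = f1 at *
  generalize deriv (deriv (deriv k)) = k3 at *
  generalize deriv (deriv k) = k2 at *
  generalize deriv k = k1 at *
  have a1 : (deriv fun s => (1 - f1 s * k s) / 2) = fun s => -(f2 s * k s + f1 s * k1 s) / 2 := by
    funext s
    refine ((((e1 s).mul (j0 s)).const_sub 1).div_const 2).deriv.trans ?_
    ring
  have a2 : (deriv fun s => -(f2 s * k s + f1 s * k1 s) / 2) =
      fun s => -(f3 s * k s + 2 * f2 s * k1 s + f1 s * k2 s) / 2 := by
    funext s
    refine (((((e2 s).mul (j0 s)).add ((e1 s).mul (j1 s))).neg).div_const 2).deriv.trans ?_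
    ring
  have a3 : (deriv fun s => -(f3 s * k s + 2 * f2 s * k1 s + f1 s * k2 s) / 2) =
      fun s => -(f4 s * k s + 3 * f3 s * k1 s + 3 * f2 s * k2 s + f1 s * k3 s) / 2 := by
    funext s
    refine ((((((e3 s).mul (j0 s)).add (((e2 s).const_mul 2).mul (j1 s))).add
      ((e1 s).mul (j2 s))).neg).div_const 2).deriv.trans ?_
    ring
  have b1 : (deriv fun s => s * ((1 - f1 s * k s) / 2) + f s * k s) =
      fun s => (1 - f1 s * k s) / 2 + s * (-(f2 s * k s + f1 s * k1 s) / 2)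
        + (f1 s * k s + f s * k1 s) := by
    funext s
    refine (((hasDerivAt_id s).mul ((((e1 s).mul (j0 s)).const_sub 1).div_const 2)).add
      ((e0 s).mul (j0 s))).deriv.trans ?_
    simp only [id, Pi.mul_apply]
    ring
  have b2 : (deriv fun s => (1 - f1 s * k s) / 2 + s * (-(f2 s * k s + f1 s * k1 s) / 2)
        + (f1 s * k s + f s * k1 s)) =
      fun s => 2 * (-(f2 s * k s + f1 s * k1 s) / 2)
        + s * (-(f3 s * k s + 2 * f2 s * k1 s + f1 s * k2 s) / 2)
        + (f2 s * k s + 2 * f1 s * k1 s + f s * k2 s) := by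
    funext s
    refine ((((((e1 s).mul (j0 s)).const_sub 1).div_const 2).add ((hasDerivAt_id s).mul
      (((((e2 s).mul (j0 s)).add ((e1 s).mul (j1 s))).neg).div_const 2))).add
      (((e1 s).mul (j0 s)).add ((e0 s).mul (j1 s)))).deriv.trans ?_
    simp only [id, Pi.mul_apply, Pi.add_apply, Pi.neg_apply]
    ring
  have b3 : (deriv fun s => 2 * (-(f2 s * k s + f1 s * k1 s) / 2)
        + s * (-(f3 s * k s + 2 * f2 s * k1 s + f1 s * k2 s) / 2)
        + (f2 s * k s + 2 * f1 s * k1 s + f s * k2 s)) =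
      fun s => 3 * (-(f3 s * k s + 2 * f2 s * k1 s + f1 s * k2 s) / 2)
        + s * (-(f4 s * k s + 3 * f3 s * k1 s + 3 * f2 s * k2 s + f1 s * k3 s) / 2)
        + (f3 s * k s + 3 * f2 s * k1 s + 3 * f1 s * k2 s + f s * k3 s) := by
    funext s
    refine ((((((((e2 s).mul (j0 s)).add ((e1 s).mul (j1 s))).neg).div_const 2).const_mul 2).add
      ((hasDerivAt_id s).mul ((((((e3 s).mul (j0 s)).add (((e2 s).const_mul 2).mul (j1 s))).add
      ((e1 s).mul (j2 s))).neg).div_const 2))).add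
      ((((e2 s).mul (j0 s)).add (((e1 s).const_mul 2).mul (j1 s))).add
        ((e0 s).mul (j2 s)))).deriv.trans ?_
    simp only [id, Pi.mul_apply, Pi.add_apply, Pi.neg_apply]
    ring
  simp only [a1, a2, a3, b1, b2, b3] at hL
  -- In `D'` the terms `2 f' f''` cancel, leaving `2 f f'''`.
  let D : ℝ → ℝ := fun s => 2 * f s * f2 s - f1 s ^ 2
  let D1 : ℝ → ℝ := fun s => 2 * f s * f3 s
  let D2 : ℝ → ℝ := fun s => 2 * f1 s * f3 s + 2 * f s * f4 s
  have d0 : ∀ s, HasDerivAt D (D1 s) s := by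
    intro s
    refine ((((e0 s).const_mul 2).mul (e2 s)).sub ((e1 s).pow 2)).congr_deriv ?_
    simp only [D1]
    ring
  have d1 : ∀ s, HasDerivAt D1 (D2 s) s := by
    intro s
    refine (((e0 s).const_mul 2).mul (e3 s)).congr_deriv ?_
    simp only [D2]
  -- Differentiating `k D = f'` twice determines `k'` and `k''` without quotients.
  have r0 : (fun s => k s * D s) = f1 := funext hkD
  have r1 : (fun s => k1 s * D s + k s * D1 s) = f2 := by
    funext s
    have h := (j0 s).mul (d0 s)
    change HasDerivAt (fun s => k s * D s) _ s at h
    rw [r0] at h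
    exact h.unique (e1 s)
  have r2 : ∀ s, k2 s * D s + 2 * k1 s * D1 s + k s * D2 s = f3 s := by
    intro s
    have h := ((j1 s).mul (d0 s)).add ((j0 s).mul (d1 s))
    change HasDerivAt (fun s => k1 s * D s + k s * D1 s) _ s at h
    rw [r1] at h
    have := h.unique (e2 s)
    linarith
  have hf1 : ∀ s, s ≠ 0 → f1 s ≠ 0 := by
    have hm : StrictMono f1 := strictMono_of_hasDerivAt_pos e1 hpos2
    have h0 : f1 0 = 0 := by
      have := odd1 0
      simp only [neg_zero] at this
      linarith
    intro s hs h
    exact hs (hm.injective (h.trans h0.symm))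
  have key : ∀ s, f1 s * (f1 s * D1 s * D s - 3 / 2 * f s * D1 s ^ 2 + f s * D2 s * D s) = 0 := by
    intro s
    have p0 : k s * D s = f1 s := hkD s
    have p1 : k1 s * D s + k s * D1 s = f2 s := congrFun r1 s
    have p2 := r2 s
    have hD0 : D s = 2 * f s * f2 s - f1 s ^ 2 := rfl
    have hD1 : D1 s = 2 * f s * f3 s := rfl
    have hD2 : D2 s = 2 * f1 s * f3 s + 2 * f s * f4 s := rfl
    have q1 : D s ^ 2 * k1 s = D s * f2 s - f1 s * D1 s := by
      linear_combination D s * p1 - D1 s * p0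
    have q2 : D s ^ 3 * k2 s =
        D s ^ 2 * f3 s - 2 * D1 s * (D s * f2 s - f1 s * D1 s) - D s * f1 s * D2 s := by
      linear_combination D s ^ 2 * p2 - 2 * D1 s * q1 - D s * D2 s * p0
    -- In the Landsberg equation both the terms with an explicit factor `s` and those with `k'''`
    -- cancel.
    have hA : k s * (f s * f4 s + f1 s * f3 s / 2) + 3 * f s * f3 s * k1 s
        + 3 / 2 * D s * k2 s = 0 := by
      rw [hD0]
      linear_combination -hL s
    have hB : f1 s * (f1 s * D1 s * D s - 3 / 2 * f s * D1 s ^ 2 + f s * D2 s * D s) =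
        -(f s * D s * (f s * f4 s + f1 s * f3 s / 2) * f1 s
          + 3 * f s ^ 2 * f3 s * (D s * f2 s - f1 s * D1 s)
          + 3 / 2 * f s * (D s ^ 2 * f3 s - 2 * D1 s * (D s * f2 s - f1 s * D1 s)
            - D s * f1 s * D2 s)) := by
      rw [hD0, hD1, hD2]
      ring
    linear_combination hB - f s * D s ^ 2 * hA
      + f s * D s * (f s * f4 s + f1 s * f3 s / 2) * p0
      + 3 * f s ^ 2 * f3 s * q1 + 3 / 2 * f s * q2
  -- The square of the main scalar along the line; the bracket in `key` is a factor of its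
  -- derivative.
  let J : ℝ → ℝ := fun s => (f s * D1 s) ^ 2 / D s ^ 3
  have hJ : ∀ s, HasDerivAt J (2 * f s * D1 s / D s ^ 4 *
      (f1 s * D1 s * D s - 3 / 2 * f s * D1 s ^ 2 + f s * D2 s * D s)) s := by
    intro s
    have hDs : D s ≠ 0 := (hD s).ne'
    refine ((((e0 s).mul (d1 s)).pow 2).div ((d0 s).pow 3) (pow_ne_zero 3 hDs)).congr_deriv ?_
    simp only [Pi.mul_apply, Pi.pow_apply]
    field_simp
    ring
  have hD10 : ∀ s, s ≠ 0 →
      f1 s * D1 s * D s - 3 / 2 * f s * D1 s ^ 2 + f s * D2 s * D s = 0 := fun s hs =>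
    (mul_eq_zero.mp (key s)).resolve_left (hf1 s hs)
  have h30 : f3 0 = 0 := by
    have := odd3 0
    simp only [neg_zero] at this
    linarith
  have hJ' : ∀ s, HasDerivAt J 0 s := by
    intro s
    refine (hJ s).congr_deriv ?_
    -- At `0`, where `f'` cannot be cancelled, `J'` vanishes through its factor `D1 0 = 2 f(0)
    -- f'''(0)`.
    rcases eq_or_ne s 0 with rfl | hs
    · simp [D1, h30]
    · rw [hD10 s hs, mul_zero]
  have hJc : J t = J 0 := is_const_of_deriv_eq_zero (fun s => (hJ' s).differentiableAt)
    (fun s => (hJ' s).deriv) t 0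
  have hJ0 : J 0 = 0 := by simp [J, D1, h30]
  have hDt : D t ≠ 0 := (hD t).ne'
  rw [hJ0] at hJc
  have h : (f t * D1 t) ^ 2 = 0 := (div_eq_zero_iff.mp hJc).resolve_right (pow_ne_zero 3 hDt)
  have h2 : f t * (2 * f t * f3 t) = 0 := pow_eq_zero_iff (two_ne_zero) |>.mp h
  have := (hpos t).ne'
  simpa [this] using h2

/-- A smooth even function whose third derivative vanishes is a quadratic polynomial in `t²`. -/
theorem eq_add_mul_sq_of_deriv_deriv_deriv_eq_zero {f : ℝ → ℝ} (hf : ContDiff ℝ ∞ f)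
    (heven : ∀ t, f (-t) = f t) (h3 : ∀ t, deriv (deriv (deriv f)) t = 0) (t : ℝ) :
    f t = f 0 + deriv (deriv f) 0 / 2 * t ^ 2 := by
  have hfc1 := contDiff_deriv_of_contDiff hf
  have hfc2 := contDiff_deriv_of_contDiff hfc1
  have e0 := hasDerivAt_deriv_of_contDiff hf
  have e1 := hasDerivAt_deriv_of_contDiff hfc1
  have odd1 := deriv_neg_of_even heven 0
  have h2 : ∀ s, deriv (deriv f) s = deriv (deriv f) 0 := fun s =>
    is_const_of_deriv_eq_zero (hfc2.differentiable (by simp)) h3 s 0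
  have d1 : ∀ s, HasDerivAt (fun s => deriv f s - deriv (deriv f) 0 * s) 0 s := by
    intro s
    refine ((e1 s).sub ((hasDerivAt_id s).const_mul _)).congr_deriv ?_
    simp [h2 s]
  have h1 : ∀ s, deriv f s = deriv (deriv f) 0 * s := by
    intro s
    have := is_const_of_deriv_eq_zero (fun s => (d1 s).differentiableAt)
      (fun s => (d1 s).deriv) s 0
    simp only [neg_zero, mul_zero] at this odd1
    linarith
  have d0 : ∀ s, HasDerivAt (fun s => f s - deriv (deriv f) 0 / 2 * s ^ 2) 0 s := by
    intro s
    refine ((e0 s).sub (((hasDerivAt_id s).pow 2).const_mul _)).congr_deriv ?_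
    simp [h1 s]
    ring
  have := is_const_of_deriv_eq_zero (fun s => (d0 s).differentiableAt)
    (fun s => (d0 s).deriv) t 0
  simp at this
  linarith

/-! ### Logarithmic polar coordinates and the shape of the metric in them. -/

/-- The standard isometry between `ℂ` and the model plane. -/
def complexIso : ℂ ≃ₗᵢ[ℝ] Vec 2 := Complex.orthonormalBasisOneI.repr

@[simp] theorem complexIso_zero (z : ℂ) : complexIso z 0 = z.re := by
  exact congrFun (Complex.orthonormalBasisOneI_repr_apply z) 0

@[simp] theorem complexIso_one (z : ℂ) : complexIso z 1 = z.im := by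
  exact congrFun (Complex.orthonormalBasisOneI_repr_apply z) 1

/-- The logarithmic polar coordinates `(log r, θ)` on the slit plane. -/
def logPolar : OpenPartialHomeomorph (Vec 2) (Vec 2) :=
  (complexIso.symm.toHomeomorph.toOpenPartialHomeomorph.trans
    Complex.expOpenPartialHomeomorph.symm).trans
    complexIso.toHomeomorph.toOpenPartialHomeomorph

theorem logPolar_symm_apply (x : Vec 2) :
    logPolar.symm x = complexIso (Complex.exp (complexIso.symm x)) := rfl

theorem mem_logPolar_source {x : Vec 2} :
    x ∈ logPolar.source ↔ complexIso.symm x ∈ Complex.slitPlane := by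
  simp [logPolar]
  rfl

theorem zero_mem_logPolar_target : (0 : Vec 2) ∈ logPolar.target := by
  simp [logPolar, Complex.expOpenPartialHomeomorph, Real.pi_pos]

theorem isLocalCoordinates_logPolar : IsLocalCoordinates puncturedPlane logPolar where
  source_subset := by
    intro x hx h
    rw [Set.mem_singleton_iff] at h
    rw [mem_logPolar_source, h, map_zero] at hx
    exact Complex.slitPlane_ne_zero hx rfl
  smooth := by
    intro x hx
    rw [mem_logPolar_source] at hx
    refine ContDiffAt.contDiffWithinAt ?_
    exact complexIso.contDiff.contDiffAt.comp x (ContDiffAt.comp (g := Complex.log)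
      (f := complexIso.symm) x ((Complex.contDiffAt_log hx).restrict_scalars ℝ)
      complexIso.symm.contDiff.contDiffAt)
  smooth_symm := by
    have h : ContDiff ℝ ∞ fun x : Vec 2 => complexIso (Complex.exp (complexIso.symm x)) :=
      complexIso.contDiff.comp
      (((Complex.contDiff_exp (𝕜 := ℂ)).restrict_scalars ℝ).comp complexIso.symm.contDiff)
    exact h.contDiffOn

theorem fderiv_logPolar_symm (x y : Vec 2) :
    fderiv ℝ logPolar.symm x y =
      complexIso (Complex.exp (complexIso.symm x) * complexIso.symm y) := by
  have h1 := complexIso.symm.toContinuousLinearEquiv.hasFDerivAt (x := x)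
  have h2 := ((Complex.hasDerivAt_exp (complexIso.symm x)).hasFDerivAt).restrictScalars ℝ
  have h3 := complexIso.toContinuousLinearEquiv.hasFDerivAt
    (x := Complex.exp (complexIso.symm x))
  have h := h3.comp x (h2.comp x h1)
  change HasFDerivAt logPolar.symm _ x at h
  rw [h.fderiv]
  simp [mul_comm]

theorem alphaPart_span_singleton_sq {n : ℕ} {V : Vec n → Submodule ℝ (Vec n)} {x v : Vec n}
    (hV : V x = Submodule.span ℝ {v}) (y : Vec n) :
    alphaPart V x y ^ 2 = inner ℝ v y ^ 2 / ‖v‖ ^ 2 := by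
  rcases eq_or_ne v 0 with rfl | hv
  · simp [alphaPart, hV]
  have hn : ‖v‖ ≠ 0 := by simpa using hv
  simp only [alphaPart, hV, Submodule.starProjection_singleton, norm_smul, mul_pow]
  simp
  field_simp
  exact sq_abs _

theorem alphaPart_angularBundle_sq (x y : Vec 2) :
    alphaPart angularBundle x y ^ 2 = (x 0 * y 1 - x 1 * y 0) ^ 2 / ‖x‖ ^ 2 := by
  rw [alphaPart_span_singleton_sq (v := dTheta x) rfl]
  simp [EuclideanSpace.norm_sq_eq, PiLp.inner_apply, Fin.sum_univ_two, dTheta]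
  ring

theorem alphaPart_radialBundle_sq {x : Vec 2} (hx : x ≠ 0) (y : Vec 2) :
    alphaPart radialBundle x y ^ 2 = (x 0 * y 0 + x 1 * y 1) ^ 2 / ‖x‖ ^ 2 := by
  have hn : ‖x‖ ≠ 0 := by simpa using hx
  rw [alphaPart_span_singleton_sq (v := x) (by
    unfold radialBundle dRadius
    exact Submodule.span_singleton_smul_eq (IsUnit.mk0 _ (inv_ne_zero hn)) x)]
  simp [PiLp.inner_apply, Fin.sum_univ_two]
  ring

/-- The point `(1, 0)`. -/
def basePoint : Vec 2 := EuclideanSpace.single 0 1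

theorem basePoint_ne_zero : basePoint ≠ 0 := by
  simp [basePoint]

/-- In its adapted frame, an `(α₁, α₂)`-metric on the punctured plane is a fixed norm. -/
theorem apply_eq_apply_basePoint {F : Vec 2 → Vec 2 → ℝ}
    (hF : IsAlphaOneTwoMetric puncturedPlane angularBundle radialBundle F)
    {x : Vec 2} (hx : x ≠ 0) {y z : Vec 2}
    (h0 : (x 0 * y 0 + x 1 * y 1) ^ 2 / ‖x‖ ^ 2 = z 0 ^ 2)
    (h1 : (x 0 * y 1 - x 1 * y 0) ^ 2 / ‖x‖ ^ 2 = z 1 ^ 2) :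
    F x y = F basePoint z := by
  obtain ⟨L, hL⟩ := hF.exists_eq_sqrt
  rw [hL x hx, hL basePoint basePoint_ne_zero, alphaPart_angularBundle_sq,
    alphaPart_radialBundle_sq hx, alphaPart_angularBundle_sq,
    alphaPart_radialBundle_sq basePoint_ne_zero, h0, h1]
  simp [basePoint]

/-- The differential of `exp` is a rotation by `θ` scaled by `r = e^{x⁰}`. It therefore carries the
coordinate frame to `r` times the orthonormal radial and angular frame. -/
theorem inCoordinates_logPolar {F : Vec 2 → Vec 2 → ℝ}
    (hF : IsAlphaOneTwoMetric puncturedPlane angularBundle radialBundle F) (x y : Vec 2) :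
    inCoordinates logPolar F x y = Real.exp (x 0) * F basePoint y := by
  rw [← (hF.finsler.minkowski _ basePoint_ne_zero).homogeneous _ _ (Real.exp_pos _)]
  have hx : logPolar.symm x ≠ 0 := by
    rw [logPolar_symm_apply]
    simp
  have hre : (complexIso.symm x).re = x 0 := by
    rw [← complexIso_zero, LinearIsometryEquiv.apply_symm_apply]
  have h0 : (complexIso.symm y).re = y 0 := by
    rw [← complexIso_zero, LinearIsometryEquiv.apply_symm_apply]
  have h1 : (complexIso.symm y).im = y 1 := by
    rw [← complexIso_one, LinearIsometryEquiv.apply_symm_apply]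
  have hn : ‖logPolar.symm x‖ = Real.exp (x 0) := by
    rw [logPolar_symm_apply, LinearIsometryEquiv.norm_map, Complex.norm_exp, hre]
  have hs := Real.sin_sq_add_cos_sq (complexIso.symm x).im
  have he := Real.exp_ne_zero (x 0)
  rw [inCoordinates]
  apply apply_eq_apply_basePoint hF hx <;> rw [hn, fderiv_logPolar_symm, logPolar_symm_apply] <;>
    simp [Complex.exp_re, Complex.exp_im, hre, h0, h1] <;>
    generalize Real.sin (complexIso.symm x).im = s at * <;>
    generalize Real.cos (complexIso.symm x).im = c at * <;>
    generalize Real.exp (x 0) = e at * <;> field_simp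
  · rw [show c * (c * y 0 - s * y 1) + s * (c * y 1 + y 0 * s) = (s ^ 2 + c ^ 2) * y 0 by ring,
      hs, one_mul]
  · rw [show c * (c * y 1 + s * y 0) - s * (c * y 0 - y 1 * s) = (s ^ 2 + c ^ 2) * y 1 by ring,
      hs, one_mul]

/-! ### Derivatives of the energy along the line `(1, t)`. -/

theorem contDiffOn_partialD {n : ℕ} {f : Vec n → ℝ} {s : Set (Vec n)} (hf : ContDiffOn ℝ ∞ f s)
    (hs : IsOpen s) (i : Fin n) : ContDiffOn ℝ ∞ (partialD i f) s :=
  (hf.fderiv_of_isOpen hs (by simp)).clm_apply contDiffOn_const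

theorem fderiv_apply_eq_sum_partialD (f : Vec 2 → ℝ) (x v : Vec 2) :
    fderiv ℝ f x v = v 0 * partialD 0 f x + v 1 * partialD 1 f x := by
  have hv : v = v 0 • EuclideanSpace.single 0 1 + v 1 • EuclideanSpace.single 1 1 := by
    ext i; fin_cases i <;> simp
  conv_lhs => rw [hv]
  simp [partialD]

/-- Euler's identity for the square of a Minkowski norm on the plane. -/
theorem IsMinkowskiNorm.euler {N : Vec 2 → ℝ} (hN : IsMinkowskiNorm N) {y : Vec 2} (hy : y ≠ 0) :
    y 0 * partialD 0 (fun z => N z ^ 2) y + y 1 * partialD 1 (fun z => N z ^ 2) y =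
      2 * N y ^ 2 := by
  have hd : DifferentiableAt ℝ (fun z => N z ^ 2) y :=
    ((hN.smooth.contDiffAt (isOpen_compl_singleton.mem_nhds hy)).pow 2).differentiableAt (by simp)
  have h1 : HasDerivAt (fun c : ℝ => c • y) y 1 := by
    simpa using (hasDerivAt_id (1 : ℝ)).smul_const y
  have hd' : HasFDerivAt (fun z => N z ^ 2) (fderiv ℝ (fun z => N z ^ 2) y) ((1 : ℝ) • y) := by
    rw [one_smul]
    exact hd.hasFDerivAt
  have h2 := hd'.comp_hasDerivAt 1 h1
  have h3 : HasDerivAt (fun c : ℝ => c ^ 2 * N y ^ 2) (2 * N y ^ 2) 1 := by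
    simpa using (hasDerivAt_pow 2 (1 : ℝ)).mul_const (N y ^ 2)
  -- Homogeneity holds only for `c > 0`, hence an equality of germs at `1`.
  have h4 : (fun c : ℝ => c ^ 2 * N y ^ 2) =ᶠ[nhds 1]
      ((fun z => N z ^ 2) ∘ fun c : ℝ => c • y) := by
    filter_upwards [lt_mem_nhds (zero_lt_one (α := ℝ))] with c hc
    simp [hN.homogeneous c y hc, mul_pow]
  rw [← fderiv_apply_eq_sum_partialD]
  exact h2.unique (h3.congr_of_eventuallyEq h4.symm)

/-- The affine line `t ↦ (1, t)`. -/
def line (t : ℝ) : Vec 2 := !₂[1, t]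

@[simp] theorem line_zero (t : ℝ) : line t 0 = 1 := rfl

@[simp] theorem line_one (t : ℝ) : line t 1 = t := rfl

theorem line_ne_zero (t : ℝ) : line t ≠ 0 := by
  intro h
  have := congrArg (fun v : Vec 2 => v 0) h
  simp at this

theorem hasDerivAt_line (t : ℝ) : HasDerivAt line (EuclideanSpace.single 1 1) t := by
  have h : line = fun s => EuclideanSpace.single 0 1 + s • EuclideanSpace.single 1 1 := by
    funext s
    ext i; fin_cases i <;> simp
  rw [h]
  simpa using ((hasDerivAt_id t).smul_const
    (EuclideanSpace.single 1 1 : Vec 2)).const_add (EuclideanSpace.single 0 1)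

theorem contDiff_line : ContDiff ℝ ∞ line := by
  have h : line = fun s => EuclideanSpace.single 0 1 + s • EuclideanSpace.single 1 1 := by
    funext s
    ext i; fin_cases i <;> simp
  rw [h]
  fun_prop

theorem contDiff_comp_line {g : Vec 2 → ℝ} (hg : ContDiffOn ℝ ∞ g {0}ᶜ) :
    ContDiff ℝ ∞ fun t => g (line t) :=
  hg.comp_contDiff contDiff_line line_ne_zero

theorem deriv_comp_line {g : Vec 2 → ℝ} (hg : ContDiffOn ℝ ∞ g {0}ᶜ) :
    (deriv fun t => g (line t)) = fun t => partialD 1 g (line t) := by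
  funext t
  have hd : DifferentiableAt ℝ g (line t) :=
    (hg.contDiffAt (isOpen_compl_singleton.mem_nhds (line_ne_zero t))).differentiableAt (by simp)
  exact (hd.hasFDerivAt.comp_hasDerivAt t (hasDerivAt_line t)).deriv

/-- The restriction of the energy of a norm to the line `t ↦ (1, t)`. -/
def lineEnergy (N : Vec 2 → ℝ) (t : ℝ) : ℝ := N (line t) ^ 2

theorem contDiffOn_energy {N : Vec 2 → ℝ} (hN : IsMinkowskiNorm N) :
    ContDiffOn ℝ ∞ (fun z => N z ^ 2) {0}ᶜ := hN.smooth.pow 2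

theorem contDiff_lineEnergy {N : Vec 2 → ℝ} (hN : IsMinkowskiNorm N) :
    ContDiff ℝ ∞ (lineEnergy N) :=
  contDiff_comp_line (contDiffOn_energy hN)

theorem partialD_one_line {N : Vec 2 → ℝ} (hN : IsMinkowskiNorm N) (t : ℝ) :
    partialD 1 (fun z => N z ^ 2) (line t) = deriv (lineEnergy N) t :=
  (congrFun (deriv_comp_line (contDiffOn_energy hN)) t).symm

theorem partialD_zero_line {N : Vec 2 → ℝ} (hN : IsMinkowskiNorm N) (t : ℝ) :
    partialD 0 (fun z => N z ^ 2) (line t) = 2 * lineEnergy N t - t * deriv (lineEnergy N) t := by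
  have h := hN.euler (line_ne_zero t)
  rw [partialD_one_line hN] at h
  simp only [line_zero, line_one] at h
  rw [lineEnergy]
  linarith

theorem hessianMatrix_one_one_line {N : Vec 2 → ℝ} (hN : IsMinkowskiNorm N) (t : ℝ) :
    hessianMatrix N (line t) 1 1 = deriv (deriv (lineEnergy N)) t / 2 := by
  have h := deriv_comp_line (contDiffOn_partialD (contDiffOn_energy hN) isOpen_compl_singleton 1)
  have h2 : (fun s => partialD 1 (fun z => N z ^ 2) (line s)) = deriv (lineEnergy N) :=
    funext (partialD_one_line hN)
  rw [h2] at h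
  rw [h]
  simp [hessianMatrix]
  ring

theorem hessianMatrix_zero_one_line {N : Vec 2 → ℝ} (hN : IsMinkowskiNorm N) (t : ℝ) :
    hessianMatrix N (line t) 0 1 =
      (deriv (lineEnergy N) t - t * deriv (deriv (lineEnergy N)) t) / 2 := by
  have h := deriv_comp_line (contDiffOn_partialD (contDiffOn_energy hN) isOpen_compl_singleton 0)
  have h2 : (fun s => partialD 0 (fun z => N z ^ 2) (line s)) = _ :=
    funext (partialD_zero_line hN)
  have hc := contDiff_lineEnergy hN
  have h3 := ((hasDerivAt_deriv_of_contDiff hc t).const_mul 2).sub ((hasDerivAt_id t).mul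
    (hasDerivAt_deriv_of_contDiff (contDiff_deriv_of_contDiff hc) t))
  rw [h2] at h
  have h4 := (congrFun h t).symm.trans h3.deriv
  simp [hessianMatrix, h4]
  ring

/-- Symmetry of the mixed derivatives is part of positive definiteness of the Hessian matrix. -/
theorem hessianMatrix_one_zero_line {N : Vec 2 → ℝ} (hN : IsMinkowskiNorm N) (t : ℝ) :
    hessianMatrix N (line t) 1 0 =
      (deriv (lineEnergy N) t - t * deriv (deriv (lineEnergy N)) t) / 2 := by
  rw [← hessianMatrix_zero_one_line hN]
  simpa using ((hN.posDef _ (line_ne_zero t)).isHermitian.apply 1 0).symm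

/-- Differentiating Euler's identity in `y⁰` expresses this entry through `g_10` and a first
derivative. -/
theorem hessianMatrix_zero_zero_line {N : Vec 2 → ℝ} (hN : IsMinkowskiNorm N) (t : ℝ) :
    hessianMatrix N (line t) 0 0 =
      (2 * lineEnergy N t - 2 * t * deriv (lineEnergy N) t
        + t ^ 2 * deriv (deriv (lineEnergy N)) t) / 2 := by
  have hs : ∀ i, DifferentiableAt ℝ (partialD i fun z => N z ^ 2) (line t) := fun i =>
    ((contDiffOn_partialD (contDiffOn_energy hN) isOpen_compl_singleton i).contDiffAt
      (isOpen_compl_singleton.mem_nhds (line_ne_zero t))).differentiableAt (by simp)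
  have hd : DifferentiableAt ℝ (fun z => N z ^ 2) (line t) :=
    ((contDiffOn_energy hN).contDiffAt
      (isOpen_compl_singleton.mem_nhds (line_ne_zero t))).differentiableAt (by simp)
  have hp : ∀ i, HasFDerivAt (fun z : Vec 2 => z i)
      (EuclideanSpace.proj i : Vec 2 →L[ℝ] ℝ) (line t) := fun i =>
    (EuclideanSpace.proj i : Vec 2 →L[ℝ] ℝ).hasFDerivAt
  have h1 := ((hp 0).mul (hs 0).hasFDerivAt).add ((hp 1).mul (hs 1).hasFDerivAt)
  have h2 := hd.hasFDerivAt.const_mul 2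
  have h3 : (fun z : Vec 2 => z 0 * partialD 0 (fun z => N z ^ 2) z
      + z 1 * partialD 1 (fun z => N z ^ 2) z) =ᶠ[nhds (line t)] fun z => 2 * N z ^ 2 := by
    filter_upwards [isOpen_compl_singleton.mem_nhds (line_ne_zero t)] with z hz
    exact hN.euler hz
  have h4 := congrArg (fun A : Vec 2 →L[ℝ] ℝ => A (EuclideanSpace.single 0 1))
    (h1.unique (h2.congr_of_eventuallyEq h3))
  have h5 := hessianMatrix_one_zero_line hN t
  have h6 := partialD_zero_line hN t
  simp [hessianMatrix] at h4 h5 ⊢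
  simp only [partialD] at h4 h5 h6 ⊢
  linear_combination h4 / 2 - t * h5 + h6 / 2

/-! ### The spray of the conformal metric and the Landsberg condition on the line. -/

/-- The metric `e^{x⁰} N(y)`, conformal to the Minkowski norm `N`. -/
def conformalMetric (N : Vec 2 → ℝ) (x y : Vec 2) : ℝ := Real.exp (x 0) * N y

/-- The spray coefficients of `e^{x⁰} N(y)` at the origin. -/
theorem sprayCoeff_conformalMetric (N : Vec 2 → ℝ) (z : Vec 2) :
    sprayCoeff (conformalMetric N) 0 z 0 = (hessianMatrix N z).det⁻¹ / 2 *
      (hessianMatrix N z 1 1 * (z 0 * partialD 0 (fun y => N y ^ 2) z - N z ^ 2)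
        - hessianMatrix N z 0 1 * (z 0 * partialD 1 (fun y => N y ^ 2) z)) ∧
    sprayCoeff (conformalMetric N) 0 z 1 = (hessianMatrix N z).det⁻¹ / 2 *
      (hessianMatrix N z 0 0 * (z 0 * partialD 1 (fun y => N y ^ 2) z)
        - hessianMatrix N z 1 0 * (z 0 * partialD 0 (fun y => N y ^ 2) z - N z ^ 2)) := by
  have h0 : conformalMetric N 0 = N := by
    funext y
    simp [conformalMetric]
  have hx : ∀ y, HasFDerivAt (fun w => conformalMetric N w y ^ 2)
      ((2 * N y ^ 2) • (EuclideanSpace.proj 0 : Vec 2 →L[ℝ] ℝ)) 0 := by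
    intro y
    have h1 : HasFDerivAt (fun w : Vec 2 => w 0) (EuclideanSpace.proj 0 : Vec 2 →L[ℝ] ℝ) 0 :=
      (EuclideanSpace.proj 0 : Vec 2 →L[ℝ] ℝ).hasFDerivAt
    refine ((h1.exp.mul_const (N y)).pow 2).congr_fderiv ?_
    ext v
    simp
    ring
  have hx0 : ∀ y, partialD 0 (fun w => conformalMetric N w y ^ 2) 0 = 2 * N y ^ 2 := by
    intro y
    simp [partialD, (hx y).fderiv]
  have hx1 : ∀ y, partialD 1 (fun w => conformalMetric N w y ^ 2) 0 = 0 := by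
    intro y
    simp [partialD, (hx y).fderiv]
  have h2 : ∀ l, partialD l (fun y => 2 * N y ^ 2) z = 2 * partialD l (fun y => N y ^ 2) z := by
    intro l
    have : (fun y => 2 * N y ^ 2) = (2 : ℝ) • fun y => N y ^ 2 := by
      funext y
      simp
    simp only [partialD]
    rw [this, fderiv_const_smul_field]
    simp
  have h3 : ∀ l, partialD l (fun _ : Vec 2 => (0 : ℝ)) z = 0 := by
    intro l
    simp [partialD]
  simp only [sprayCoeff, Fin.sum_univ_two, hx0, hx1, h0, h2, h3, Matrix.inv_def,
    Matrix.adjugate_fin_two, Ring.inverse_eq_inv']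
  constructor <;> simp <;> ring

theorem contDiffOn_hessianMatrix {N : Vec 2 → ℝ} (hN : IsMinkowskiNorm N) (i j : Fin 2) :
    ContDiffOn ℝ ∞ (fun z => hessianMatrix N z i j) {0}ᶜ :=
  contDiffOn_const.mul (contDiffOn_partialD (contDiffOn_partialD (contDiffOn_energy hN)
    isOpen_compl_singleton i) isOpen_compl_singleton j)

theorem contDiffOn_sprayCoeff_conformalMetric {N : Vec 2 → ℝ} (hN : IsMinkowskiNorm N)
    (i : Fin 2) : ContDiffOn ℝ ∞ (fun z => sprayCoeff (conformalMetric N) 0 z i) {0}ᶜ := by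
  have hh := contDiffOn_hessianMatrix hN
  have hd : ContDiffOn ℝ ∞ (fun z => (hessianMatrix N z).det⁻¹ / 2) {0}ᶜ := by
    refine ContDiffOn.div_const (ContDiffOn.inv ?_ fun z hz => (hN.posDef z hz).det_pos.ne') 2
    simp only [Matrix.det_fin_two]
    exact ((hh 0 0).mul (hh 1 1)).sub ((hh 0 1).mul (hh 1 0))
  have hp := contDiffOn_partialD (contDiffOn_energy hN) isOpen_compl_singleton
  have hz : ContDiffOn ℝ ∞ (fun z : Vec 2 => z 0) {0}ᶜ :=
    (EuclideanSpace.proj 0 : Vec 2 →L[ℝ] ℝ).contDiff.contDiffOn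
  have hq := (hz.mul (hp 0)).sub (contDiffOn_energy hN)
  fin_cases i
  · exact (hd.mul (((hh 1 1).mul hq).sub ((hh 0 1).mul (hz.mul (hp 1))))).congr
      fun z _ => (sprayCoeff_conformalMetric N z).1
  · exact (hd.mul (((hh 0 0).mul (hz.mul (hp 1))).sub ((hh 1 0).mul hq))).congr
      fun z _ => (sprayCoeff_conformalMetric N z).2

theorem deriv_deriv_deriv_comp_line {g : Vec 2 → ℝ} (hg : ContDiffOn ℝ ∞ g {0}ᶜ) :
    (deriv (deriv (deriv fun t => g (line t)))) =
      fun t => partialD 1 (partialD 1 (partialD 1 g)) (line t) := by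
  have h1 := contDiffOn_partialD hg isOpen_compl_singleton 1
  rw [deriv_comp_line hg, deriv_comp_line h1,
    deriv_comp_line (contDiffOn_partialD h1 isOpen_compl_singleton 1)]

/-- A Minkowski norm `N` on the plane, symmetric in the line `y¹ = 0`, for which `e^{x⁰} N(y)` has
vanishing Landsberg curvature at the origin, is Euclidean on the line `t ↦ (1, t)`. -/
theorem lineEnergy_eq_of_landsberg {N : Vec 2 → ℝ} (hN : IsMinkowskiNorm N)
    (heven : ∀ t, N (line (-t)) = N (line t))
    (hL : ∀ t, ∑ i, ∑ j, line t j * hessianMatrix N (line t) i j *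
      partialD 1 (partialD 1 (partialD 1 fun z => sprayCoeff (conformalMetric N) 0 z i))
        (line t) = 0) (t : ℝ) :
    lineEnergy N t = lineEnergy N 0 + deriv (deriv (lineEnergy N)) 0 / 2 * t ^ 2 := by
  have hf := contDiff_lineEnergy hN
  have he : ∀ t, lineEnergy N (-t) = lineEnergy N t := fun t => by simp [lineEnergy, heven]
  have h00 := hessianMatrix_zero_zero_line hN
  have h01 := hessianMatrix_zero_one_line hN
  have h10 := hessianMatrix_one_zero_line hN
  have h11 := hessianMatrix_one_one_line hN
  have hp0 := partialD_zero_line hN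
  have hp1 := partialD_one_line hN
  have hNf : ∀ t, N (line t) ^ 2 = lineEnergy N t := fun _ => rfl
  have hdet : ∀ t, (hessianMatrix N (line t)).det =
      (2 * lineEnergy N t * deriv (deriv (lineEnergy N)) t - deriv (lineEnergy N) t ^ 2) / 4 := by
    intro t
    rw [Matrix.det_fin_two, h00, h01, h10, h11]
    ring
  have hD : ∀ t,
      0 < 2 * lineEnergy N t * deriv (deriv (lineEnergy N)) t - deriv (lineEnergy N) t ^ 2 := by
    intro t
    have := (hN.posDef _ (line_ne_zero t)).det_pos
    rw [hdet] at this
    linarith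
  have hpos : ∀ t, 0 < lineEnergy N t := by
    intro t
    have : N (line t) ≠ 0 := fun h => line_ne_zero t ((hN.eq_zero_iff _).mp h)
    exact pow_pos (lt_of_le_of_ne (hN.nonneg _) this.symm) 2
  have hpos2 : ∀ t, 0 < deriv (deriv (lineEnergy N)) t := by
    intro t
    have := (hN.posDef _ (line_ne_zero t)).diag_pos (i := 1)
    rw [h11] at this
    linarith
  -- With the determinant equal to `D / 4`, this coefficient is `(f f'' - f'^2) / D`, which is `(1 -
  -- f'^2 / D) / 2`.
  have hG0 : (fun s => sprayCoeff (conformalMetric N) 0 (line s) 0) = fun s =>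
      (1 - deriv (lineEnergy N) s * (deriv (lineEnergy N) s / (2 * lineEnergy N s *
        deriv (deriv (lineEnergy N)) s - deriv (lineEnergy N) s ^ 2))) / 2 := by
    funext s
    have := (hD s).ne'
    rw [(sprayCoeff_conformalMetric N (line s)).1, hdet, h11, h01, hp0, hp1, hNf, line_zero]
    field_simp
    ring
  have hG1 : (fun s => sprayCoeff (conformalMetric N) 0 (line s) 1) = fun s =>
      s * ((1 - deriv (lineEnergy N) s * (deriv (lineEnergy N) s / (2 * lineEnergy N s *
        deriv (deriv (lineEnergy N)) s - deriv (lineEnergy N) s ^ 2))) / 2) +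
        lineEnergy N s * (deriv (lineEnergy N) s / (2 * lineEnergy N s *
        deriv (deriv (lineEnergy N)) s - deriv (lineEnergy N) s ^ 2)) := by
    funext s
    have := (hD s).ne'
    rw [(sprayCoeff_conformalMetric N (line s)).2, hdet, h00, h10, hp0, hp1, hNf, line_zero]
    field_simp
    ring
  have hf1 := contDiff_deriv_of_contDiff hf
  have hf2 := contDiff_deriv_of_contDiff hf1
  refine eq_add_mul_sq_of_deriv_deriv_deriv_eq_zero hf he
    (deriv_deriv_deriv_eq_zero_of_landsberg hf
      (k := fun s => deriv (lineEnergy N) s / (2 * lineEnergy N s *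
        deriv (deriv (lineEnergy N)) s - deriv (lineEnergy N) s ^ 2))
      (hf1.div (((contDiff_const.mul hf).mul hf2).sub (hf1.pow 2)) fun s => (hD s).ne') he hpos
      hpos2 hD (fun s => div_mul_cancel₀ _ (hD s).ne') ?_) t
  intro s
  rw [← hG0, ← hG1,
    deriv_deriv_deriv_comp_line (contDiffOn_sprayCoeff_conformalMetric hN 0),
    deriv_deriv_deriv_comp_line (contDiffOn_sprayCoeff_conformalMetric hN 1)]
  have h := hL s
  simp only [Fin.sum_univ_two, h00, h01, h10, h11, line_zero, line_one] at h
  -- The lowered vector `y^j g_ij` is half the gradient of `N^2`, that is `((2 f - t f') / 2, f' /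
  -- 2)`.
  linear_combination 2 * h

/-! ### From the line to the whole plane, and the conclusion. -/

/-- A reflection-symmetric norm that is Euclidean on the line `t ↦ (1, t)` is Euclidean. -/
theorem sq_eq_of_lineEnergy_eq {N : Vec 2 → ℝ} (hN : IsMinkowskiNorm N)
    (heven : ∀ y z : Vec 2, y 0 ^ 2 = z 0 ^ 2 → y 1 ^ 2 = z 1 ^ 2 → N y = N z) {a b : ℝ}
    (h : ∀ t, lineEnergy N t = a + b * t ^ 2) (y : Vec 2) :
    N y ^ 2 = a * y 0 ^ 2 + b * y 1 ^ 2 := by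
  have hpos : ∀ s t : ℝ, 0 < s → N !₂[s, t] ^ 2 = a * s ^ 2 + b * t ^ 2 := by
    intro s t hs
    have h1 : (!₂[s, t] : Vec 2) = s • line (t / s) := by
      ext i; fin_cases i
      · simp
      · simp
        field_simp
    rw [h1, hN.homogeneous s _ hs, mul_pow, ← lineEnergy, h]
    field_simp
  -- Rays through the line fill only the open half-plane `s > 0`; continuity adds the axis `s = 0`,
  -- and reflection then gives `s < 0`.
  have hclos : ∀ s t : ℝ, 0 ≤ s → N !₂[s, t] ^ 2 = a * s ^ 2 + b * t ^ 2 := by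
    intro s t hs
    have hc : Continuous fun s : ℝ => (!₂[s, t] : Vec 2) := by
      refine (PiLp.continuous_toLp 2 _).comp (continuous_pi fun i => ?_)
      fin_cases i
      · exact continuous_id
      · exact continuous_const
    have hcl : IsClosed {s : ℝ | N !₂[s, t] ^ 2 = a * s ^ 2 + b * t ^ 2} :=
      isClosed_eq ((hN.continuous.comp hc).pow 2) (by fun_prop)
    have hsub := hcl.closure_subset_iff.mpr (fun s hs => hpos s t hs : Set.Ioi (0 : ℝ) ⊆ _)
    rw [closure_Ioi] at hsub
    exact hsub hs
  rw [heven y !₂[|y 0|, y 1] (by simp) (by simp), hclos _ _ (abs_nonneg _), sq_abs]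

end Finsler

end

open Finsler in
theorem mainTheorem5 (F : Finsler.Vec 2 → Finsler.Vec 2 → ℝ)
    (hF : Finsler.IsAlphaOneTwoMetric Finsler.puncturedPlane
      Finsler.angularBundle Finsler.radialBundle F)
    (hnR : ¬ Finsler.IsRiemannian Finsler.puncturedPlane F) :
    ¬ Finsler.IsLandsberg Finsler.puncturedPlane F := by
  intro hL
  refine hnR ?_
  have hN := hF.finsler.minkowski _ basePoint_ne_zero
  have hsymm : ∀ y z : Vec 2, y 0 ^ 2 = z 0 ^ 2 → y 1 ^ 2 = z 1 ^ 2 →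
      F basePoint y = F basePoint z := fun y z h0 h1 =>
    apply_eq_apply_basePoint hF basePoint_ne_zero (by simpa [basePoint] using h0)
      (by simpa [basePoint] using h1)
  have hcoord : inCoordinates logPolar F = conformalMetric (F basePoint) := by
    funext x y
    exact inCoordinates_logPolar hF x y
  have hzero : conformalMetric (F basePoint) 0 = F basePoint := by
    funext y
    simp [conformalMetric]
  have hline := lineEnergy_eq_of_landsberg hN (fun t => hsymm _ _ (by simp) (by simp)) fun t => by
    have h := hL logPolar isLocalCoordinates_logPolar 0 zero_mem_logPolar_target (line t)
      (line_ne_zero t) 1 1 1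
    rwa [hcoord, hzero] at h
  have hquad := sq_eq_of_lineEnergy_eq hN hsymm hline
  intro x hx
  set a := lineEnergy (F basePoint) 0
  set b := deriv (deriv (lineEnergy (F basePoint))) 0 / 2
  -- `u` and `v` are `‖x‖` times the radial and angular components, whence the division of `a` and
  -- `b` by `‖x‖ ^ 2`.
  let u : Vec 2 →ₗ[ℝ] ℝ :=
    x 0 • (EuclideanSpace.proj 0 : Vec 2 →L[ℝ] ℝ) + x 1 • (EuclideanSpace.proj 1 : Vec 2 →L[ℝ] ℝ)
  let v : Vec 2 →ₗ[ℝ] ℝ :=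
    x 0 • (EuclideanSpace.proj 1 : Vec 2 →L[ℝ] ℝ) - x 1 • (EuclideanSpace.proj 0 : Vec 2 →L[ℝ] ℝ)
  refine ⟨(a / ‖x‖ ^ 2) • QuadraticMap.linMulLin u u
    + (b / ‖x‖ ^ 2) • QuadraticMap.linMulLin v v, fun y => ?_⟩
  rw [apply_eq_apply_basePoint hF hx (y := y)
    (z := !₂[(x 0 * y 0 + x 1 * y 1) / ‖x‖, (x 0 * y 1 - x 1 * y 0) / ‖x‖])
    (by simp [div_pow]) (by simp [div_pow]), hquad]
  simp [u, v]
  ring
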